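/- Fix a real number $0<\delta<1/2$. There is a constant $C=C(\delta)>0$, depending only on $\delta$, with the following property. Let $A>0$ be any real number, let $n,m\ge 0$ be integers with $\delta n^2\le m\le (1-\delta)n^2$ and $m\le\binom n2$, and let $k\ge 0$ be an integer with $k\le A\log n$ (that is, $k=O(\log n)$ with an arbitrary implied constant $A$, on which $C$ does not depend; for $n=0$ only $k=0$ is considered). Let $G(n,m)$ be the random graph distributed uniformly over all simple graphs on $n$ labelled vertices with exactly $m$ edges, and let $X_{n,m}$ be the number of spanning trees of $G(n,m)$. Then $$\mathbb{E}\big[X_{n,m}^k\big]\le C^k\,\big(\mathbb{E}X_{n,m}\big)^k .$$ -/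

import Mathlib

/-- The law `G(n,m)` of the uniform random graph: the uniform probability measure on the simple
graphs on `n` labelled vertices that have exactly `m` edges. -/
noncomputable def uniformRandomGraph (n m : ℕ) :
    MeasureTheory.Measure (SimpleGraph (Fin n)) :=
  ProbabilityTheory.uniformOn {G : SimpleGraph (Fin n) | G.edgeSet.ncard = m}

/-- The number of spanning trees of a graph `G`: the number of trees on the whole vertex set of `G`
all of whose edges are edges of `G`. -/
noncomputable def numSpanningTrees {n : ℕ} (G : SimpleGraph (Fin n)) : ℕ :=
  {T : SimpleGraph (Fin n) | T ≤ G ∧ T.IsTree}.ncard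

/-- Every set of graphs on finitely many vertices is measurable; in particular every real function
of `G(n,m)` is a random variable. -/
instance instDiscreteMeasurableSpaceSimpleGraphFin (n : ℕ) :
    DiscreteMeasurableSpace (SimpleGraph (Fin n)) where
  forall_measurableSet s :=
    ⟨SimpleGraph.Adj '' s, MeasurableSet.of_discrete,
      Set.preimage_image_eq s fun _ _ h => SimpleGraph.ext h⟩

/-- `G(n,m)` is a probability law as soon as there are at least `m` possible edges. -/
theorem isProbabilityMeasure_uniformRandomGraph {n m : ℕ} (h : m ≤ n.choose 2) :
    MeasureTheory.IsProbabilityMeasure (uniformRandomGraph n m) := by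
  refine ProbabilityTheory.isProbabilityMeasure_uniformOn' (Set.toFinite _) ?_
    (MeasurableSet.of_discrete)
  obtain ⟨s, hs, hc⟩ := Finset.exists_subset_card_eq
    (s := (⊤ : SimpleGraph (Fin n)).edgeFinset) (n := m)
    (by rw [SimpleGraph.card_edgeFinset_top_eq_card_choose_two, Fintype.card_fin]; exact h)
  refine ⟨SimpleGraph.fromEdgeSet (s : Set (Sym2 (Fin n))), ?_⟩
  have hd : ((s : Set (Sym2 (Fin n))) \ {e | e.IsDiag}) = s := by
    ext e
    simp only [Set.mem_sdiff, Finset.mem_coe, Set.mem_ofPred_eq, and_iff_left_iff_imp]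
    intro he
    exact SimpleGraph.not_isDiag_of_mem_edgeFinset (hs he)
  change (SimpleGraph.fromEdgeSet (s : Set (Sym2 (Fin n)))).edgeSet.ncard = m
  rw [SimpleGraph.edgeSet_fromEdgeSet]
  erw [hd]
  rw [Set.ncard_coe_finset, hc]

/-! The bound holds graph by graph: every graph with `m` edges has at most `exp (4 / δ)` times the
mean number of spanning trees, and moments follow by raising this to the power `k` and averaging.
Let `L` be the Laplacian of `G`, `J` the all-ones matrix, `N = n.choose 2`. The matrix-tree theorem,
in the form `det (L + t J) = t n² X(G)` (`det_lapMatrix_add`), and AM-GM on the eigenvalues of `L +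
t J` bound `X(G)` by edge count alone. At the density `t = m / N` the mean eigenvalue is `t n`,
which gives `X(G) ≤ t ^ (n - 1) X(K_n)` (`ncard_trees_le_pow_mul`). By double counting, `E X` is
`X(K_n)` times the ratio of the falling factorials of `m` and `N` of length `n - 1`. Since `m ≥ δ
n²`, the falling factorial of `m` is within `exp (4 / δ)` of `m ^ (n - 1)`. -/

open Finset Matrix

/-! ### Cauchy–Binet and ordered column choices -/

/-- The Cauchy–Binet formula, as a sum over ordered choices of columns. -/
theorem Matrix.card_factorial_mul_det_mul {V X R : Type*} [Fintype V] [DecidableEq V] [Fintype X]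
    [DecidableEq X] [CommRing R] (A : Matrix V X R) (B : Matrix X V R) :
    ((Fintype.card V).factorial : R) * (A * B).det =
      ∑ f : V → X, (A.submatrix id f).det * (B.submatrix f id).det := by
  -- Permuting the rows by `σ` and multiplying by its sign leaves the determinant unchanged; summing
  -- over all `σ` produces the factorial and assembles the determinant of the `A` factor.
  have h : ∀ σ : Equiv.Perm V, (A * B).det =
      ∑ τ : Equiv.Perm V, ∑ f : V → X,
        ((Equiv.Perm.sign σ : ℤ) : R) * (Equiv.Perm.sign τ : ℤ) *
          ((∏ i, A (σ i) (f i)) * ∏ i, B (f i) (τ i)) := by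
    intro σ
    have h1 : (((A * B).submatrix σ id)ᵀ).det =
        ∑ τ : Equiv.Perm V, ((Equiv.Perm.sign τ : ℤ) : R) *
          ∑ f : V → X, ((∏ i, A (σ i) (f i)) * ∏ i, B (f i) (τ i)) := by
      rw [det_apply']
      refine sum_congr rfl fun τ _ => ?_
      simp only [transpose_apply, submatrix_apply, id, mul_apply, prod_univ_sum,
        Fintype.piFinset_univ, prod_mul_distrib]
    rw [det_transpose, det_permute] at h1
    have h2 : ((Equiv.Perm.sign σ : ℤ) : R) * ((Equiv.Perm.sign σ : ℤ) : R) = 1 := by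
      rw [← Int.cast_mul, ← Units.val_mul, Int.units_mul_self]; simp
    rw [← one_mul (A * B).det, ← h2, mul_assoc, h1, mul_sum]
    simp only [mul_sum, mul_assoc]
  have h3 : ((Fintype.card V).factorial : R) * (A * B).det = ∑ _σ : Equiv.Perm V, (A * B).det := by
    rw [sum_const, card_univ, Fintype.card_perm, nsmul_eq_mul]
  rw [h3, sum_congr rfl fun σ _ => h σ]
  rw [sum_congr rfl fun σ _ => sum_comm, sum_comm]
  refine sum_congr rfl fun f _ => ?_
  rw [det_apply', ← det_transpose (B.submatrix f id), det_apply', sum_mul_sum]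
  refine sum_congr rfl fun σ _ => sum_congr rfl fun τ _ => ?_
  simp only [submatrix_apply, transpose_apply, id]
  ring

theorem card_injective_range_eq {V X : Type*} [Fintype V] [DecidableEq V] [Fintype X]
    [DecidableEq X] (S : Set X) (hS : S.ncard = Fintype.card V) :
    {f : V → X | Function.Injective f ∧ Set.range f = S}.ncard = (Fintype.card V).factorial := by
  classical
  have e : {f : V → X | Function.Injective f ∧ Set.range f = S} ≃ (V ≃ S) :=
    { toFun := fun f => (Equiv.ofInjective f.1 f.2.1).trans (Equiv.setCongr f.2.2)
      invFun := fun g => ⟨fun v => g v, Subtype.val_injective.comp g.injective, by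
        ext x
        constructor
        · rintro ⟨v, rfl⟩; exact (g v).2
        · intro hx; exact ⟨g.symm ⟨x, hx⟩, by simp⟩⟩
      left_inv := fun f => by ext; rfl
      right_inv := fun g => by ext; rfl }
  have hc : Fintype.card V = Fintype.card S := by
    rw [← hS, Set.ncard_eq_toFinset_card', Set.toFinset_card]
  rw [← Nat.card_coe_set_eq, Nat.card_congr e, Nat.card_eq_fintype_card,
    Fintype.card_equiv (Fintype.equivOfCardEq hc)]

/-! ### Minors of the bordered incidence matrix -/

section MatrixTree

variable {V : Type*} [LinearOrder V]

/-- The oriented incidence matrix of the complete graph on `V`, with one further column of ones. -/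
def bordInc (V : Type*) [LinearOrder V] : Matrix V (Option (Sym2 V)) ℤ :=
  Matrix.of fun v c => c.elim 1 fun e =>
    (Pi.single e.inf 1 : V → ℤ) v - (Pi.single e.sup 1 : V → ℤ) v

theorem bordInc_none (v : V) : bordInc V v none = 1 := rfl

theorem bordInc_some (v : V) (e : Sym2 V) : bordInc V v (some e) =
    (Pi.single e.inf 1 : V → ℤ) v - (Pi.single e.sup 1 : V → ℤ) v := rfl

variable [Fintype V]

theorem sum_bordInc_some (e : Sym2 V) : ∑ v, bordInc V v (some e) = 0 := by
  simp [bordInc_some, Finset.sum_sub_distrib]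

theorem sum_mul_bordInc_some (x : V → ℤ) (u v : V) (h : x u = x v) :
    ∑ w, x w * bordInc V w (some s(u, v)) = 0 := by
  simp only [bordInc_some, mul_sub, Finset.sum_sub_distrib, Pi.single_apply, mul_ite, mul_one,
    mul_zero, Finset.sum_ite_eq', Finset.mem_univ, if_true, Sym2.inf_mk,
    Sym2.sup_mk]
  rcases le_total u v with huv | huv <;> simp [huv, h]

theorem det_eq_zero_of_sum_col_eq_zero {M : Matrix V V ℤ} {x : V → ℤ} (hx : x ≠ 0)
    (h : ∀ j, ∑ i, x i * M i j = 0) : M.det = 0 :=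
  exists_vecMul_eq_zero_iff.1 ⟨x, hx, funext fun j => h j⟩

/-- The columns generate `ℤ^V`: one is the basis vector at `r`, and the edge columns are differences
of basis vectors, so walks to `r` reach every other basis vector. Surjectivity over `ℤ` makes the
determinant a unit. -/
theorem isUnit_det_of_connected {T : SimpleGraph V} (hT : T.Connected) (r i₀ : V)
    (f : V → Option (Sym2 V)) (h0 : f i₀ = none) (hf : ∀ e ∈ T.edgeSet, some e ∈ Set.range f) :
    IsUnit (((bordInc V).submatrix id f).updateCol i₀ (Pi.single r 1)).det := by
  set M := ((bordInc V).submatrix id f).updateCol i₀ (Pi.single r 1) with hM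
  rw [← Matrix.isUnit_iff_isUnit_det, ← Matrix.mulVec_surjective_iff_isUnit]
  have hcol : ∀ j, M.col j ∈ LinearMap.range M.mulVecLin := fun j =>
    ⟨Pi.single j 1, by simp⟩
  have hr : (Pi.single r 1 : V → ℤ) ∈ LinearMap.range M.mulVecLin := by
    have := hcol i₀
    rwa [show M.col i₀ = Pi.single r 1 by ext v; simp [hM]] at this
  have hadj : ∀ u v, T.Adj u v →
      (Pi.single (u ⊓ v) 1 - Pi.single (u ⊔ v) 1 : V → ℤ) ∈ LinearMap.range M.mulVecLin := by
    intro u v huv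
    obtain ⟨j, hj⟩ := hf s(u, v) huv
    have hne : j ≠ i₀ := by rintro rfl; rw [h0] at hj; cases hj
    have := hcol j
    rwa [show M.col j = (Pi.single (u ⊓ v) 1 - Pi.single (u ⊔ v) 1 : V → ℤ) by
      ext w; simp [hM, hne, hj, bordInc_some]] at this
  have hadj' : ∀ u v, T.Adj u v →
      (Pi.single v 1 - Pi.single u 1 : V → ℤ) ∈ LinearMap.range M.mulVecLin := by
    intro u v huv
    have := hadj u v huv
    rcases le_total u v with h | h
    · simp only [inf_eq_left.2 h, sup_eq_right.2 h] at this
      simpa using neg_mem this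
    · simpa only [inf_eq_right.2 h, sup_eq_left.2 h] using this
  have hwalk : ∀ u v, T.Walk u v → (Pi.single v 1 : V → ℤ) ∈ LinearMap.range M.mulVecLin →
      (Pi.single u 1 : V → ℤ) ∈ LinearMap.range M.mulVecLin := by
    intro u v p hv
    induction p with
    | nil => exact hv
    | cons huv _ ih => simpa using sub_mem (ih hv) (hadj' _ _ huv)
  have hall : ∀ v, (Pi.single v 1 : V → ℤ) ∈ LinearMap.range M.mulVecLin := fun v =>
    (hT.preconnected v r).elim fun p => hwalk v r p hr
  intro y
  have : y ∈ LinearMap.range M.mulVecLin := by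
    rw [← Finset.univ_sum_single y]
    refine sum_mem fun v _ => ?_
    have := Submodule.smul_mem _ (y v) (hall v)
    rwa [← Pi.single_smul, smul_eq_mul, mul_one] at this
  exact this

/-- The column of ones is the sum of the basis vectors. By linearity the determinant is a sum of `n`
equal terms, each `±1`. -/
theorem sq_det_of_connected {T : SimpleGraph V} (hT : T.Connected) (i₀ : V)
    (f : V → Option (Sym2 V)) (h0 : f i₀ = none) (hinj : Function.Injective f)
    (hf : ∀ e ∈ T.edgeSet, some e ∈ Set.range f) :
    ((bordInc V).submatrix id f).det ^ 2 = (Fintype.card V : ℤ) ^ 2 := by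
  set M := (bordInc V).submatrix id f with hM
  -- Replacing the column of ones by a difference of two basis vectors makes every column sum to
  -- zero, so the two terms agree.
  have hsub : ∀ v, M.cramer (Pi.single v 1) i₀ = M.cramer (Pi.single i₀ 1) i₀ := by
    intro v
    rw [← sub_eq_zero, ← Pi.sub_apply, ← map_sub, cramer_apply]
    refine det_eq_zero_of_sum_col_eq_zero (x := fun _ => 1)
      (fun h => one_ne_zero (congrFun h i₀)) fun j => ?_
    simp only [one_mul]
    by_cases hj : j = i₀
    · subst hj
      simp [Finset.sum_sub_distrib]
    · simp only [updateCol_ne hj, hM, submatrix_apply, id]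
      cases h : f j with
      | none => exact absurd (hinj (h.trans h0.symm)) hj
      | some e => exact sum_bordInc_some e
  have h1 : M.det = M.cramer (∑ v, Pi.single v 1) i₀ := by
    rw [cramer_apply]
    congr 1
    ext a b
    by_cases hb : b = i₀
    · subst hb
      simp [hM, h0, bordInc_none, Finset.sum_apply, Pi.single_apply]
    · simp [updateCol_ne hb]
  rw [map_sum, Finset.sum_apply, Finset.sum_congr rfl fun v _ => hsub v, Finset.sum_const,
    Finset.card_univ, nsmul_eq_mul, cramer_apply] at h1
  rw [h1, mul_pow, Int.isUnit_sq (isUnit_det_of_connected hT i₀ i₀ f h0 hf), mul_one]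

theorem injective_of_det_ne_zero {f : V → Option (Sym2 V)}
    (h : ((bordInc V).submatrix id f).det ≠ 0) : Function.Injective f := by
  intro i j hij
  by_contra hne
  exact h (det_zero_of_column_eq hne fun k => by simp [hij])

theorem none_mem_range_of_det_ne_zero [Nonempty V] {f : V → Option (Sym2 V)}
    (h : ((bordInc V).submatrix id f).det ≠ 0) : none ∈ Set.range f := by
  by_contra hn
  refine h (det_eq_zero_of_sum_col_eq_zero (x := fun _ => 1)
    (fun h => one_ne_zero (congrFun h (Classical.arbitrary V))) fun j => ?_)
  simp only [one_mul, submatrix_apply, id]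
  cases hj : f j with
  | none => exact absurd ⟨j, hj⟩ hn
  | some e => exact sum_bordInc_some e

/-- If `H` were disconnected, the indicator of a component, scaled and shifted to have sum zero,
would be a nonzero vector orthogonal to every column: it is constant along edges and kills the
column of ones. -/
theorem connected_of_det_ne_zero [Nonempty V] {f : V → Option (Sym2 V)} {H : SimpleGraph V}
    (hH : ∀ e, some e ∈ Set.range f → e ∈ H.edgeSet)
    (h : ((bordInc V).submatrix id f).det ≠ 0) : H.Connected := by
  classical
  by_contra hc
  have : ¬ H.Preconnected := fun hp => hc ⟨hp⟩
  simp only [SimpleGraph.Preconnected, not_forall] at this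
  obtain ⟨r, w, hrw⟩ := this
  set y : V → ℤ := fun v => if H.Reachable r v then 1 else 0 with hy
  set c : ℤ := ∑ v, y v with hcdef
  have hcard : (Fintype.card V : ℤ) ≠ 0 := by exact_mod_cast Fintype.card_ne_zero
  refine h (det_eq_zero_of_sum_col_eq_zero (x := fun v => Fintype.card V * y v - c) ?_ fun j => ?_)
  · intro h0
    have h1 := congrFun h0 r
    have h2 := congrFun h0 w
    simp only [hy, SimpleGraph.Reachable.refl, if_true, hrw, if_false, Pi.zero_apply] at h1 h2
    apply hcard
    linarith
  · simp only [submatrix_apply, id]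
    cases hj : f j with
    | none =>
      simp only [bordInc_none, mul_one, Finset.sum_sub_distrib, ← Finset.mul_sum, Finset.sum_const,
        Finset.card_univ, nsmul_eq_mul, ← hcdef, sub_self]
    | some e =>
      have he := hH e ⟨j, hj⟩
      induction e with
      | _ u v =>
        have huv : H.Adj u v := he
        apply sum_mul_bordInc_some
        have : H.Reachable r u ↔ H.Reachable r v :=
          ⟨fun h => h.trans huv.reachable, fun h => h.trans huv.symm.reachable⟩
        simp only [hy, this]

end MatrixTree

/-! ### The matrix-tree theorem -/

section MatrixTree

variable {V : Type*} [LinearOrder V]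

theorem bordInc_sq_some (v : V) (e : Sym2 V) (he : ¬ e.IsDiag) :
    bordInc V v (some e) * bordInc V v (some e) = if v ∈ e then 1 else 0 := by
  induction e with
  | _ a b =>
    have hab : a ≠ b := by simpa using he
    simp only [bordInc_some, Pi.single_apply, Sym2.inf_mk, Sym2.sup_mk, Sym2.mem_iff]
    rcases le_total a b with h | h <;> simp only [inf_eq_left.2, inf_eq_right.2, sup_eq_left.2,
      sup_eq_right.2, h] <;> grind

theorem bordInc_mul_some (u v : V) (huv : u ≠ v) (e : Sym2 V) :
    bordInc V u (some e) * bordInc V v (some e) = if e = s(u, v) ∧ ¬ e.IsDiag then -1 else 0 := by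
  induction e with
  | _ a b =>
    simp only [bordInc_some, Pi.single_apply, Sym2.inf_mk, Sym2.sup_mk, Sym2.eq_iff,
      Sym2.mk_isDiag_iff]
    rcases le_total a b with h | h <;> simp only [inf_eq_left.2, inf_eq_right.2, sup_eq_left.2,
      sup_eq_right.2, h] <;> grind

variable [Fintype V]

/-- Weights of the columns: `t` for the column of ones, the indicator of `G` for the edges. -/
def columnWeight (G : SimpleGraph V) [DecidableRel G.Adj] (t : ℝ) (c : Option (Sym2 V)) : ℝ :=
  c.elim t fun e => if e ∈ G.edgeSet then 1 else 0

theorem lapMatrix_add_eq (G : SimpleGraph V) [DecidableRel G.Adj] (t : ℝ) :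
    (Matrix.of fun v c => columnWeight G t c * (bordInc V v c : ℝ)) *
      (Matrix.of fun c v => (bordInc V v c : ℝ)) =
    G.lapMatrix ℝ + t • Matrix.of fun _ _ => 1 := by
  ext u v
  simp only [mul_apply, of_apply, Fintype.sum_option, Matrix.add_apply, Matrix.smul_apply, smul_eq_mul, mul_one,
    bordInc_none, Int.cast_one]
  rw [add_comm]
  congr 1
  · simp only [SimpleGraph.lapMatrix, SimpleGraph.degMatrix, Matrix.sub_apply,
      SimpleGraph.adjMatrix_apply, mul_assoc, ← Int.cast_mul, columnWeight, Option.elim_some]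
    by_cases huv : u = v
    · subst huv
      rw [diagonal_apply_eq, if_neg (G.loopless.irrefl u), sub_zero,
        ← SimpleGraph.card_incidenceFinset_eq_degree, SimpleGraph.incidenceFinset_eq_filter,
        Finset.card_filter, Nat.cast_sum]
      have : ∀ e : Sym2 V, ((if e ∈ G.edgeSet then (1 : ℝ) else 0) *
          ((bordInc V u (some e) * bordInc V u (some e) : ℤ) : ℝ)) =
          if e ∈ G.edgeFinset then ((if u ∈ e then 1 else 0 : ℕ) : ℝ) else 0 := by
        intro e
        by_cases he : e ∈ G.edgeSet
        · rw [bordInc_sq_some u e (G.not_isDiag_of_mem_edgeSet he)]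
          simp [he]
        · simp [he]
      rw [Finset.sum_congr rfl fun e _ => this e, Finset.sum_ite_mem, Finset.univ_inter]
    · rw [diagonal_apply_ne _ huv, zero_sub]
      have : ∀ e : Sym2 V, ((if e ∈ G.edgeSet then (1 : ℝ) else 0) *
          ((bordInc V u (some e) * bordInc V v (some e) : ℤ) : ℝ)) =
          if e = s(u, v) then - (if G.Adj u v then (1 : ℝ) else 0) else 0 := by
        intro e
        rw [bordInc_mul_some u v huv e]
        by_cases he : e = s(u, v)
        · subst he
          simp [huv]
        · simp [he]
      rw [Finset.sum_congr rfl fun e _ => this e, Finset.sum_ite_eq' ]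
      simp

theorem factorial_mul_det_lapMatrix_add (G : SimpleGraph V) [DecidableRel G.Adj] (t : ℝ) :
    ((Fintype.card V).factorial : ℝ) * (G.lapMatrix ℝ + t • Matrix.of fun _ _ => 1).det =
      ∑ f : V → Option (Sym2 V), (∏ i, columnWeight G t (f i)) *
        ((((bordInc V).submatrix id f).det ^ 2 : ℤ) : ℝ) := by
  rw [← lapMatrix_add_eq, Matrix.card_factorial_mul_det_mul]
  refine Finset.sum_congr rfl fun f _ => ?_
  have h1 : ((Matrix.of fun c v => (bordInc V v c : ℝ)).submatrix f id).det =
      (((bordInc V).submatrix id f).det : ℝ) := by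
    rw [← det_transpose]
    exact (Int.cast_det _).symm
  have h2 : ((Matrix.of fun v c => columnWeight G t c * (bordInc V v c : ℝ)).submatrix id f).det =
      (∏ i, columnWeight G t (f i)) * (((bordInc V).submatrix id f).det : ℝ) := by
    rw [Int.cast_det, ← det_mul_row]
    rfl
  rw [h1, h2]
  push_cast
  ring

/-- The choices of columns that pick the column of ones and the edges of `T`. -/
def columnChoices (T : SimpleGraph V) : Set (V → Option (Sym2 V)) :=
  {f | Function.Injective f ∧ Set.range f = insert none (some '' T.edgeSet)}

theorem ncard_columnChoices {T : SimpleGraph V} (hT : T.IsTree) :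
    (columnChoices T).ncard = (Fintype.card V).factorial := by
  refine card_injective_range_eq _ ?_
  rw [Set.ncard_insert_of_notMem (by simp), Set.ncard_image_of_injective _ (Option.some_injective _)]
  rw [← Nat.card_coe_set_eq, (SimpleGraph.isTree_iff_connected_and_card.1 hT).2,
    Nat.card_eq_fintype_card]

theorem prod_columnWeight_mul_sq {G T : SimpleGraph V} [DecidableRel G.Adj] (t : ℝ) (hT : T.IsTree)
    (hTG : T ≤ G) {f : V → Option (Sym2 V)} (hf : f ∈ columnChoices T) :
    (∏ i, columnWeight G t (f i)) * ((((bordInc V).submatrix id f).det ^ 2 : ℤ) : ℝ) =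
      t * (Fintype.card V : ℝ) ^ 2 := by
  obtain ⟨hinj, hrange⟩ := hf
  obtain ⟨i₀, hi₀⟩ : none ∈ Set.range f := by rw [hrange]; exact Set.mem_insert _ _
  rw [sq_det_of_connected hT.connected i₀ f hi₀ hinj
    fun e he => by rw [hrange]; exact Or.inr ⟨e, he, rfl⟩]
  rw [Finset.prod_eq_single i₀]
  · simp [hi₀, columnWeight]
  · intro j _ hj
    have : f j ∈ insert none (some '' T.edgeSet) := hrange ▸ Set.mem_range_self j
    rcases this with h | ⟨e, he, h⟩
    · exact absurd (hinj (h.trans hi₀.symm)) hj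
    · rw [← h]
      simp [columnWeight, SimpleGraph.edgeSet_mono hTG he]
  · simp

/-- A nonzero term uses distinct columns, one of which is the column of ones. The remaining `n - 1`
are edges of `G` forming a connected graph, hence a tree. -/
theorem exists_mem_columnChoices [Nonempty V] {G : SimpleGraph V} [DecidableRel G.Adj] {t : ℝ}
    {f : V → Option (Sym2 V)} (h : (∏ i, columnWeight G t (f i)) *
      ((((bordInc V).submatrix id f).det ^ 2 : ℤ) : ℝ) ≠ 0) :
    ∃ T : SimpleGraph V, (T ≤ G ∧ T.IsTree) ∧ f ∈ columnChoices T := by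
  have hw := left_ne_zero_of_mul h
  have hd : ((bordInc V).submatrix id f).det ≠ 0 := by
    intro h0
    exact right_ne_zero_of_mul h (by simp [h0])
  have hinj := injective_of_det_ne_zero hd
  have hnone := none_mem_range_of_det_ne_zero hd
  have hE : ∀ e, some e ∈ Set.range f → e ∈ G.edgeSet := by
    rintro e ⟨i, hi⟩
    by_contra he
    exact hw (Finset.prod_eq_zero (Finset.mem_univ i) (by simp [hi, columnWeight, he]))
  set T := SimpleGraph.fromEdgeSet {e | some e ∈ Set.range f} with hT
  have hTE : T.edgeSet = {e | some e ∈ Set.range f} := by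
    rw [hT, SimpleGraph.edgeSet_fromEdgeSet, sdiff_eq_left, Set.disjoint_left]
    exact fun e he => G.not_isDiag_of_mem_edgeSet (hE e he)
  have hrange : Set.range f = insert none (some '' T.edgeSet) := by
    ext c
    cases c with
    | none => simpa using hnone
    | some e => simp [hTE]
  have hconn : T.Connected := connected_of_det_ne_zero (fun e he => by rw [hTE]; exact he) hd
  refine ⟨T, ⟨SimpleGraph.edgeSet_subset_edgeSet.1 fun e he => hE e (by rwa [hTE] at he), ?_⟩,
    hinj, hrange⟩
  refine SimpleGraph.isTree_iff_connected_and_card.2 ⟨hconn, ?_⟩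
  rw [Nat.card_coe_set_eq, ← Set.ncard_image_of_injective _ (Option.some_injective _),
    ← Set.ncard_insert_of_notMem (a := none) (by simp), ← hrange, ← Set.image_univ,
    Set.ncard_image_of_injective _ hinj, Set.ncard_univ]

/-- The matrix-tree theorem. -/
theorem det_lapMatrix_add [Nonempty V] (G : SimpleGraph V) [DecidableRel G.Adj] (t : ℝ) :
    (G.lapMatrix ℝ + t • Matrix.of fun _ _ => 1).det =
      t * (Fintype.card V : ℝ) ^ 2 * {T : SimpleGraph V | T ≤ G ∧ T.IsTree}.ncard := by
  classical
  have hfac : ((Fintype.card V).factorial : ℝ) ≠ 0 := by positivity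
  apply mul_left_cancel₀ hfac
  rw [factorial_mul_det_lapMatrix_add]
  set S : Finset (SimpleGraph V) := {T | T ≤ G ∧ T.IsTree} with hS
  have hSc : {T : SimpleGraph V | T ≤ G ∧ T.IsTree}.ncard = #S := by
    rw [← Set.ncard_coe_finset]; simp [hS]
  have hdisj : (S : Set (SimpleGraph V)).PairwiseDisjoint fun T => (columnChoices T).toFinset := by
    intro T _ T' _ hne
    refine Finset.disjoint_left.2 fun f hf hf' => hne ?_
    rw [Set.mem_toFinset] at hf hf'
    have h := hf.2.symm.trans hf'.2
    rw [← SimpleGraph.edgeSet_inj]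
    ext e
    have := Set.ext_iff.1 h (some e)
    simpa using this
  rw [← Finset.sum_subset (Finset.subset_univ (S.biUnion fun T => (columnChoices T).toFinset)),
    Finset.sum_biUnion hdisj]
  · rw [Finset.sum_congr rfl fun T hT => ?_, Finset.sum_const, hSc, nsmul_eq_mul]
    rotate_left
    · exact ((Fintype.card V).factorial : ℝ) * (t * (Fintype.card V : ℝ) ^ 2)
    · obtain ⟨hTG, hTree⟩ := (Finset.mem_filter.1 hT).2
      rw [Finset.sum_congr rfl fun f hf =>
        prod_columnWeight_mul_sq t hTree hTG (Set.mem_toFinset.1 hf), Finset.sum_const,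
        ← Set.ncard_eq_toFinset_card', ncard_columnChoices hTree, nsmul_eq_mul]
    · ring
  · intro f _ hf
    by_contra h
    obtain ⟨T, hT, hfT⟩ := exists_mem_columnChoices h
    exact hf (Finset.mem_biUnion.2 ⟨T, by simpa [hS] using hT, Set.mem_toFinset.2 hfT⟩)

end MatrixTree

/-! ### Upper bound on the number of spanning trees -/

/-- The inequality of arithmetic and geometric means for the eigenvalues of a matrix. -/
theorem Matrix.PosSemidef.det_le_trace_div_pow {V : Type*} [Fintype V] [DecidableEq V] [Nonempty V]
    {M : Matrix V V ℝ} (hM : M.PosSemidef) : M.det ≤ (M.trace / Fintype.card V) ^ Fintype.card V := by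
  have hc : (0 : ℝ) < Fintype.card V := by exact_mod_cast Fintype.card_pos
  have h := Real.geom_mean_le_arith_mean Finset.univ (fun _ => (1 : ℝ))
    hM.isHermitian.eigenvalues (fun _ _ => zero_le_one) (by simpa using hc)
    fun i _ => hM.eigenvalues_nonneg i
  have hdet : M.det = ∏ i, hM.isHermitian.eigenvalues i := by
    simpa using hM.isHermitian.det_eq_prod_eigenvalues
  have htr : M.trace = ∑ i, hM.isHermitian.eigenvalues i := by
    simpa using hM.isHermitian.trace_eq_sum_eigenvalues
  simp only [Real.rpow_one, one_mul, Finset.sum_const, Finset.card_univ, nsmul_eq_mul, mul_one,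
    ← hdet, ← htr] at h
  have hd : 0 ≤ M.det := hM.det_nonneg
  calc M.det = (M.det ^ ((Fintype.card V : ℝ)⁻¹)) ^ Fintype.card V :=
        (Real.rpow_inv_natCast_pow hd Fintype.card_ne_zero).symm
    _ ≤ _ := pow_le_pow_left₀ (Real.rpow_nonneg hd _) h _

section

variable {V : Type*} [Fintype V] [LinearOrder V] [Nonempty V]

/-- Cayley's formula: for the complete graph the Laplacian plus `J` is `n` times the identity.
Keeping the factor `n²` avoids the exponent `n - 2`. -/
theorem card_sq_mul_ncard_trees_top :
    (Fintype.card V : ℝ) ^ 2 * {T : SimpleGraph V | T ≤ ⊤ ∧ T.IsTree}.ncard =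
      (Fintype.card V : ℝ) ^ Fintype.card V := by
  have h := det_lapMatrix_add (⊤ : SimpleGraph V) 1
  have hM : (⊤ : SimpleGraph V).lapMatrix ℝ + (1 : ℝ) • Matrix.of (fun _ _ => (1 : ℝ)) =
      Matrix.diagonal fun _ => (Fintype.card V : ℝ) := by
    ext u v
    have hc : 1 ≤ Fintype.card V := Fintype.card_pos
    by_cases huv : u = v
    · subst huv
      simp [SimpleGraph.lapMatrix, SimpleGraph.degMatrix, Nat.cast_sub hc]
    · simp [SimpleGraph.lapMatrix, SimpleGraph.degMatrix, huv]
  rw [hM, det_diagonal, Finset.prod_const, Finset.card_univ, one_mul] at h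
  exact h.symm

theorem mul_card_sq_mul_ncard_trees_le (G : SimpleGraph V) {t : ℝ} (ht : 0 ≤ t) :
    t * (Fintype.card V : ℝ) ^ 2 * {T : SimpleGraph V | T ≤ G ∧ T.IsTree}.ncard ≤
      ((2 * G.edgeSet.ncard + t * Fintype.card V) / Fintype.card V) ^ Fintype.card V := by
  classical
  rw [← det_lapMatrix_add]
  have hJ : (Matrix.of fun _ _ => 1 : Matrix V V ℝ).PosSemidef := by
    have := Matrix.posSemidef_vecMulVec_self_star (fun _ : V => (1 : ℝ))
    convert this using 1
    ext u v
    simp [vecMulVec_apply]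
  refine (((SimpleGraph.posSemidef_lapMatrix ℝ G).add
    (hJ.smul ht)).det_le_trace_div_pow).trans_eq ?_
  congr 2
  rw [trace_add, trace_smul]
  congr 1
  · have := G.sum_degrees_eq_twice_card_edges
    rw [Set.ncard_eq_toFinset_card']
    simp only [Matrix.trace, Matrix.diag, SimpleGraph.lapMatrix, SimpleGraph.degMatrix,
      Matrix.sub_apply, diagonal_apply_eq, SimpleGraph.adjMatrix_apply, SimpleGraph.irrefl, if_false,
      sub_zero]
    exact_mod_cast this
  · simp [Matrix.trace]

/-- A graph whose edge density is `t` has at most `t ^ (n - 1)` times as many spanning trees as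
the complete graph. -/
theorem ncard_trees_le_pow_mul (G : SimpleGraph V) {t : ℝ} (ht : 0 < t)
    (hG : 2 * (G.edgeSet.ncard : ℝ) = t * (Fintype.card V * (Fintype.card V - 1))) :
    ({T : SimpleGraph V | T ≤ G ∧ T.IsTree}.ncard : ℝ) ≤
      t ^ (Fintype.card V - 1) * {T : SimpleGraph V | T ≤ ⊤ ∧ T.IsTree}.ncard := by
  have hc : (0 : ℝ) < Fintype.card V := by exact_mod_cast Fintype.card_pos
  have h := mul_card_sq_mul_ncard_trees_le G ht.le
  -- With `t` the edge density, the mean eigenvalue is `t n`; its `n`-th power is `t ^ n` times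
  -- Cayley's quantity, and one factor `t` cancels.
  have h1 : (2 * (G.edgeSet.ncard : ℝ) + t * Fintype.card V) / Fintype.card V =
      t * Fintype.card V := by
    rw [hG]; field_simp; ring
  rw [h1, mul_pow, ← card_sq_mul_ncard_trees_top] at h
  have h2 : t ^ Fintype.card V = t * t ^ (Fintype.card V - 1) := by
    rw [← pow_succ', Nat.sub_add_cancel Fintype.card_pos]
  rw [h2] at h
  refine le_of_mul_le_mul_left ?_ (mul_pos ht (pow_pos hc 2))
  linarith

end

/-! ### Supergraph counts and falling factorials -/

/-- The number of graphs with `m` edges that contain a given graph. -/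
theorem ncard_supergraphs {V : Type*} [Fintype V] (T : SimpleGraph V) {m : ℕ}
    (hm : T.edgeSet.ncard ≤ m) :
    {G : SimpleGraph V | T ≤ G ∧ G.edgeSet.ncard = m}.ncard =
      ((Fintype.card V).choose 2 - T.edgeSet.ncard).choose (m - T.edgeSet.ncard) := by
  classical
  have hT : T.edgeSet.ncard = #T.edgeFinset := by rw [Set.ncard_eq_toFinset_card']; rfl
  have hTtop : T.edgeFinset ⊆ (⊤ : SimpleGraph V).edgeFinset := SimpleGraph.edgeFinset_mono le_top
  have hN : (Fintype.card V).choose 2 - T.edgeSet.ncard =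
      #((⊤ : SimpleGraph V).edgeFinset \ T.edgeFinset) := by
    rw [Finset.card_sdiff_of_subset hTtop, SimpleGraph.card_edgeFinset_top_eq_card_choose_two, hT]
  rw [hN, ← Finset.card_powersetCard, ← Set.ncard_coe_finset]
  refine Set.ncard_congr (fun G _ => G.edgeFinset \ T.edgeFinset) ?_ ?_ ?_
  · rintro G ⟨hTG, hGm⟩
    rw [Finset.mem_coe, Finset.mem_powersetCard]
    refine ⟨Finset.sdiff_subset_sdiff (SimpleGraph.edgeFinset_mono le_top) le_rfl, ?_⟩
    rw [Finset.card_sdiff_of_subset (SimpleGraph.edgeFinset_mono hTG), hT, ← hGm,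
      Set.ncard_eq_toFinset_card']
    rfl
  · rintro G G' ⟨hG, _⟩ ⟨hG', _⟩ h
    rw [← SimpleGraph.edgeFinset_inj, ← Finset.sdiff_union_of_subset (SimpleGraph.edgeFinset_mono hG),
      ← Finset.sdiff_union_of_subset (SimpleGraph.edgeFinset_mono hG')]
    exact congrArg (· ∪ T.edgeFinset) h
  · intro s hs
    rw [Finset.mem_coe, Finset.mem_powersetCard] at hs
    obtain ⟨hs, hsc⟩ := hs
    have hsub : s ∪ T.edgeFinset ⊆ (⊤ : SimpleGraph V).edgeFinset :=
      Finset.union_subset (hs.trans Finset.sdiff_subset) hTtop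
    have hdisj : Disjoint s T.edgeFinset := Finset.disjoint_of_subset_left hs Finset.sdiff_disjoint
    have hE : (SimpleGraph.fromEdgeSet ((s ∪ T.edgeFinset : Finset (Sym2 V)) : Set (Sym2 V))).edgeSet
        = ((s ∪ T.edgeFinset : Finset (Sym2 V)) : Set (Sym2 V)) := by
      rw [SimpleGraph.edgeSet_fromEdgeSet, sdiff_eq_left, Set.disjoint_left]
      exact fun e he => SimpleGraph.not_isDiag_of_mem_edgeFinset (hsub he)
    refine ⟨SimpleGraph.fromEdgeSet ((s ∪ T.edgeFinset : Finset (Sym2 V)) : Set (Sym2 V)),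
      ⟨?_, ?_⟩, ?_⟩
    · rw [← SimpleGraph.edgeSet_subset_edgeSet, hE, ← SimpleGraph.coe_edgeFinset,
        Finset.coe_subset]
      exact Finset.subset_union_right
    · rw [hE, Set.ncard_coe_finset, Finset.card_union_of_disjoint hdisj, hsc, hT,
        Nat.sub_add_cancel (hT ▸ hm)]
    · apply Finset.coe_injective
      rw [Finset.coe_sdiff, SimpleGraph.coe_edgeFinset, SimpleGraph.coe_edgeFinset, hE,
        Finset.coe_union, SimpleGraph.coe_edgeFinset, Set.union_sdiff_right]
      refine sdiff_eq_left.2 ?_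
      rw [← SimpleGraph.coe_edgeFinset, Finset.disjoint_coe]
      exact hdisj

theorem choose_sub_mul_descFactorial {N m r : ℕ} (hr : r ≤ m) :
    (N - r).choose (m - r) * N.descFactorial r = N.choose m * m.descFactorial r := by
  rw [Nat.descFactorial_eq_factorial_mul_choose, Nat.descFactorial_eq_factorial_mul_choose]
  have := Nat.choose_mul (n := N) hr
  rw [mul_left_comm, mul_left_comm (N.choose m), this, mul_comm ((N - r).choose (m - r))]

/-- Crude bound from `m ^ m ≤ exp m * m!`, for the case where `r` is comparable to `m`. -/
theorem pow_le_exp_mul_descFactorial {m r : ℕ} (hr : r ≤ m) :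
    (m : ℝ) ^ r ≤ Real.exp m * m.descFactorial r := by
  rcases Nat.eq_zero_or_pos m with rfl | hm
  · obtain rfl : r = 0 := by omega
    simp
  have hm0 : (0 : ℝ) < m := by exact_mod_cast hm
  have h1 := Real.pow_div_factorial_le_exp (m : ℝ) hm0.le m
  rw [div_le_iff₀ (by positivity)] at h1
  have h2 : ((m - r).factorial : ℝ) * m.descFactorial r = m.factorial := by
    exact_mod_cast Nat.factorial_mul_descFactorial hr
  have h3 : ((m - r).factorial : ℝ) ≤ (m : ℝ) ^ (m - r) := by
    exact_mod_cast (Nat.factorial_le_pow _).trans (Nat.pow_le_pow_left (Nat.sub_le _ _) _)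
  have h4 : (m : ℝ) ^ m = m ^ (m - r) * m ^ r := by rw [← pow_add, Nat.sub_add_cancel hr]
  refine le_of_mul_le_mul_left ?_ (pow_pos hm0 (m - r))
  rw [← h4]
  calc (m : ℝ) ^ m ≤ Real.exp m * ((m - r).factorial * m.descFactorial r) := by rw [h2]; exact h1
    _ ≤ Real.exp m * (m ^ (m - r) * m.descFactorial r) := by gcongr
    _ = _ := by ring

/-- Each factor of the falling factorial is at least `m - r`, and `m ≤ exp (2 r / m) (m - r)` once
`2 r ≤ m`. -/
theorem pow_le_exp_mul_descFactorial_of_two_mul_le {m r : ℕ} (hr : 2 * r ≤ m) (hm : 0 < m) :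
    (m : ℝ) ^ r ≤ Real.exp (2 * r ^ 2 / m) * m.descFactorial r := by
  have hm0 : (0 : ℝ) < m := by exact_mod_cast hm
  have hr' : 2 * (r : ℝ) ≤ m := by exact_mod_cast hr
  have hpos : (0 : ℝ) < m - r := by linarith
  have h1 : ((m : ℝ) - r) ^ r ≤ m.descFactorial r := by
    rw [← Nat.cast_sub (by omega)]
    exact_mod_cast (Nat.pow_le_pow_left (by omega) r).trans (Nat.pow_sub_le_descFactorial m r)
  have h2 : (m : ℝ) ≤ Real.exp (2 * r / m) * (m - r) := by
    have h3 : (m : ℝ) ≤ (2 * r / m + 1) * (m - r) := by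
      have : (2 * (r : ℝ) / m + 1) * (m - r) = m + r * (m - 2 * r) / m := by field_simp; ring
      rw [this]
      have : 0 ≤ (r : ℝ) * (m - 2 * r) / m := by
        apply div_nonneg (mul_nonneg (by positivity) (by linarith)) hm0.le
      linarith
    exact h3.trans (mul_le_mul_of_nonneg_right (Real.add_one_le_exp _) hpos.le)
  calc (m : ℝ) ^ r ≤ (Real.exp (2 * r / m) * (m - r)) ^ r := by gcongr
    _ = Real.exp (2 * r ^ 2 / m) * (m - r) ^ r := by
        rw [mul_pow, ← Real.exp_nat_mul]; congr 2; ring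
    _ ≤ _ := by gcongr

theorem pow_le_exp_mul_descFactorial_of_sq_le {δ : ℝ} (hδ : 0 < δ) {n m r : ℕ} (hn : 0 < n)
    (hrn : r ≤ n) (hrm : r ≤ m) (hm : δ * (n : ℝ) ^ 2 ≤ m) :
    (m : ℝ) ^ r ≤ Real.exp (4 / δ) * m.descFactorial r := by
  have hn0 : (0 : ℝ) < n := by exact_mod_cast hn
  have hm0 : (0 : ℝ) < m := lt_of_lt_of_le (by positivity) hm
  have hrn' : (r : ℝ) ≤ n := by exact_mod_cast hrn
  by_cases h : 2 * r ≤ m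
  · refine (pow_le_exp_mul_descFactorial_of_two_mul_le h (by exact_mod_cast hm0)).trans ?_
    refine mul_le_mul_of_nonneg_right (Real.exp_le_exp.2 ?_) (Nat.cast_nonneg _)
    rw [div_le_div_iff₀ hm0 hδ]
    have : (r : ℝ) ^ 2 ≤ n ^ 2 := by gcongr
    nlinarith
  -- Here `δ n² ≤ m < 2 r ≤ 2 n` forces `δ n < 2`, so `m < 4 / δ`. This case fixes the constant; the
  -- other needs only `2 / δ`.
  · refine (pow_le_exp_mul_descFactorial hrm).trans ?_
    gcongr
    rw [le_div_iff₀ hδ]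
    have h' : (m : ℝ) < 2 * r := by exact_mod_cast not_le.1 h
    have h1 : δ * n < 2 := by
      by_contra h2
      nlinarith
    nlinarith

/-! ### The mean, the pointwise bound and the moments -/

theorem integral_uniformRandomGraph (n m : ℕ) (f : SimpleGraph (Fin n) → ℝ) :
    ∫ G, f G ∂(uniformRandomGraph n m) =
      (∑ G with G.edgeSet.ncard = m, f G) / (n.choose 2).choose m := by
  classical
  set s : Finset (SimpleGraph (Fin n)) := {G | G.edgeSet.ncard = m} with hs
  have hset : {G : SimpleGraph (Fin n) | G.edgeSet.ncard = m} = (s : Set (SimpleGraph (Fin n))) := by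
    simp [hs]
  have hcard : (n.choose 2).choose m = #s := by
    have := ncard_supergraphs (⊥ : SimpleGraph (Fin n)) (m := m) (by simp)
    simp only [bot_le, true_and, SimpleGraph.edgeSet_bot, Set.ncard_empty, Fintype.card_fin,
      Nat.sub_zero] at this
    rw [← this, hset, Set.ncard_coe_finset]
  have : MeasureTheory.IsFiniteMeasure (uniformRandomGraph n m) := by
    rw [uniformRandomGraph, ProbabilityTheory.uniformOn]
    infer_instance
  rw [MeasureTheory.integral_fintype MeasureTheory.Integrable.of_finite, hcard, Finset.sum_div,
    ← Finset.sum_subset (Finset.subset_univ s)]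
  · refine Finset.sum_congr rfl fun G hG => ?_
    rw [uniformRandomGraph, hset, MeasureTheory.measureReal_def, ← Finset.coe_singleton,
      ProbabilityTheory.uniformOn_apply_finset, Finset.inter_singleton_of_mem hG]
    simp [div_eq_inv_mul]
  · intro G _ hG
    rw [uniformRandomGraph, hset, MeasureTheory.measureReal_def, ← Finset.coe_singleton,
      ProbabilityTheory.uniformOn_apply_finset, Finset.inter_singleton_of_notMem hG]
    simp

theorem ncard_edgeSet_of_isTree {n : ℕ} {T : SimpleGraph (Fin n)} (hT : T.IsTree) :
    T.edgeSet.ncard = n - 1 := by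
  have := (SimpleGraph.isTree_iff_connected_and_card.1 hT).2
  rw [Nat.card_coe_set_eq, Nat.card_eq_fintype_card, Fintype.card_fin] at this
  omega

/-- Double counting of pairs (tree, supergraph with `m` edges): every tree has `n - 1` edges, hence
equally many supergraphs. -/
theorem sum_numSpanningTrees {n m : ℕ} (hm : n - 1 ≤ m) :
    ∑ G : SimpleGraph (Fin n) with G.edgeSet.ncard = m, numSpanningTrees G =
      numSpanningTrees (⊤ : SimpleGraph (Fin n)) *
        (n.choose 2 - (n - 1)).choose (m - (n - 1)) := by
  classical
  have h1 : ∀ G : SimpleGraph (Fin n), numSpanningTrees G =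
      #{T : SimpleGraph (Fin n) | T.IsTree ∧ T ≤ G} := by
    intro G
    rw [numSpanningTrees, ← Set.ncard_coe_finset]
    simp [and_comm]
  rw [Finset.sum_congr rfl fun G _ => h1 G, h1]
  have h2 := Finset.sum_card_bipartiteAbove_eq_sum_card_bipartiteBelow
    (fun T G : SimpleGraph (Fin n) => T ≤ G) (s := {T : SimpleGraph (Fin n) | T.IsTree})
    (t := {G : SimpleGraph (Fin n) | G.edgeSet.ncard = m})
  simp only [Finset.bipartiteAbove, Finset.bipartiteBelow, Finset.filter_filter] at h2
  rw [← h2]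
  rw [Finset.sum_congr rfl fun T hT => ?_, Finset.sum_const, smul_eq_mul]
  rotate_left
  · exact (n.choose 2 - (n - 1)).choose (m - (n - 1))
  · have hT := ncard_edgeSet_of_isTree (Finset.mem_filter.1 hT).2
    have := ncard_supergraphs T (m := m) (hT ▸ hm)
    rw [hT, Fintype.card_fin] at this
    rw [← this, ← Set.ncard_coe_finset]
    simp [and_comm]
  · simp

/-- The AM-GM bound and the exact mean differ only in replacing a ratio of powers by a ratio of
falling factorials. In the denominator this only helps; in the numerator it costs `exp (4 / δ)`. -/
theorem numSpanningTrees_le_exp_mul_integral {δ : ℝ} (hδ : 0 < δ) {n m : ℕ} (hn : 2 ≤ n)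
    (hm : δ * (n : ℝ) ^ 2 ≤ m) (hmn : m ≤ n.choose 2) {G : SimpleGraph (Fin n)}
    (hG : G.edgeSet.ncard = m) :
    (numSpanningTrees G : ℝ) ≤
      Real.exp (4 / δ) * ∫ G, (numSpanningTrees G : ℝ) ∂(uniformRandomGraph n m) := by
  classical
  have : Nonempty (Fin n) := ⟨⟨0, by omega⟩⟩
  by_cases hr : n - 1 ≤ m
  · have hn0 : (0 : ℝ) < n := by positivity
    have hm0 : (0 : ℝ) < m := lt_of_lt_of_le (by positivity) hm
    have hN : (0 : ℝ) < n.choose 2 := by exact_mod_cast Nat.choose_pos hn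
    have hchoose : (0 : ℝ) < (n.choose 2).choose m := by exact_mod_cast Nat.choose_pos hmn
    have hupper := ncard_trees_le_pow_mul G (t := m / n.choose 2) (by positivity) (by
      rw [hG, Fintype.card_fin, div_mul_eq_mul_div, eq_div_iff hN.ne', Nat.cast_choose_two]
      ring)
    rw [Fintype.card_fin] at hupper
    have hsum : ∑ G : SimpleGraph (Fin n) with G.edgeSet.ncard = m, (numSpanningTrees G : ℝ) =
      numSpanningTrees (⊤ : SimpleGraph (Fin n)) *
        (n.choose 2 - (n - 1)).choose (m - (n - 1)) := by
      exact_mod_cast sum_numSpanningTrees hr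
    have hdesc : (((n.choose 2 - (n - 1)).choose (m - (n - 1)) : ℕ) : ℝ) *
        (n.choose 2).descFactorial (n - 1) = (n.choose 2).choose m * m.descFactorial (n - 1) := by
      exact_mod_cast choose_sub_mul_descFactorial hr
    have hpow : (((n.choose 2).descFactorial (n - 1) : ℕ) : ℝ) ≤ (n.choose 2 : ℝ) ^ (n - 1) := by
      exact_mod_cast Nat.descFactorial_le_pow _ _
    have hlower := pow_le_exp_mul_descFactorial_of_sq_le hδ (by omega) (Nat.sub_le n 1) hr hm
    have hratio : ((m : ℝ) / n.choose 2) ^ (n - 1) ≤ Real.exp (4 / δ) *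
        (((n.choose 2 - (n - 1)).choose (m - (n - 1)) : ℕ) / (n.choose 2).choose m) := by
      rw [div_pow, ← mul_div_assoc, div_le_div_iff₀ (by positivity) hchoose]
      calc (m : ℝ) ^ (n - 1) * (n.choose 2).choose m
          ≤ Real.exp (4 / δ) * m.descFactorial (n - 1) * (n.choose 2).choose m := by gcongr
        _ = Real.exp (4 / δ) * (((n.choose 2 - (n - 1)).choose (m - (n - 1)) : ℕ) *
              (n.choose 2).descFactorial (n - 1)) := by rw [hdesc]; ring
        _ ≤ Real.exp (4 / δ) * (((n.choose 2 - (n - 1)).choose (m - (n - 1)) : ℕ) *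
              (n.choose 2 : ℝ) ^ (n - 1)) := by gcongr
        _ = _ := by ring
    rw [integral_uniformRandomGraph, hsum]
    refine hupper.trans ((mul_le_mul_of_nonneg_right hratio (Nat.cast_nonneg _)).trans_eq ?_)
    rw [numSpanningTrees]
    ring
  · have : numSpanningTrees G = 0 := by
      rw [numSpanningTrees, Set.ncard_eq_zero]
      refine Set.eq_empty_iff_forall_notMem.2 fun T ⟨hTG, hT⟩ => hr ?_
      rw [← ncard_edgeSet_of_isTree hT, ← hG]
      exact Set.ncard_le_ncard (SimpleGraph.edgeSet_mono hTG)
    rw [this, Nat.cast_zero]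
    exact mul_nonneg (Real.exp_pos _).le (MeasureTheory.integral_nonneg fun _ => Nat.cast_nonneg _)

theorem mainTheorem2 (δ : ℝ) (hδ₀ : 0 < δ) (hδ₁ : δ < 1 / 2) :
    ∃ C : ℝ, 0 < C ∧
      ∀ A : ℝ, 0 < A →
        ∀ n m k : ℕ,
          δ * (n : ℝ) ^ 2 ≤ (m : ℝ) →
          (m : ℝ) ≤ (1 - δ) * (n : ℝ) ^ 2 →
          m ≤ n.choose 2 →
          (k : ℝ) ≤ A * Real.log (n : ℝ) →
          ∫ G, (numSpanningTrees G : ℝ) ^ k ∂(uniformRandomGraph n m) ≤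
            C ^ k * (∫ G, (numSpanningTrees G : ℝ) ∂(uniformRandomGraph n m)) ^ k := by
  refine ⟨Real.exp (4 / δ), Real.exp_pos _, fun A _ n m k hm _ hmn hk => ?_⟩
  have := isProbabilityMeasure_uniformRandomGraph hmn
  rcases Nat.lt_or_ge n 2 with hn | hn
  -- For `n = 0` this uses the convention `Real.log 0 = 0`; in both cases `k = 0`.
  · have hlog : Real.log (n : ℝ) = 0 := by interval_cases n <;> simp
    rw [hlog, mul_zero] at hk
    obtain rfl : k = 0 := by exact_mod_cast le_antisymm hk (Nat.cast_nonneg k)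
    simp
  · rw [← mul_pow]
    set B := Real.exp (4 / δ) * ∫ G, (numSpanningTrees G : ℝ) ∂(uniformRandomGraph n m)
    -- Writing the constant as its own mean under the probability law reduces the claim to a
    -- termwise comparison of sums over graphs.
    have hB : ∫ _, B ^ k ∂(uniformRandomGraph n m) = B ^ k := by simp
    rw [← hB, integral_uniformRandomGraph, integral_uniformRandomGraph n m fun _ => B ^ k]
    refine div_le_div_of_nonneg_right (Finset.sum_le_sum fun G hG => ?_) (Nat.cast_nonneg _)
    exact pow_le_pow_left₀ (Nat.cast_nonneg _)
      (numSpanningTrees_le_exp_mul_integral hδ₀ hn hm hmn (Finset.mem_filter.1 hG).2) k
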